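/- For a field $F$, call an associative unital $F$-algebra $B$ just infinite if $\dim_F B=\infty$ and $\dim_F(B/I)<\infty$ for every nonzero two-sided ideal $I$ of $B$. Let $k$ be an algebraically closed field and let $A$ be an associative unital $k$-algebra. Suppose that $A$ is just infinite, that $A$ is primitive (it has a faithful simple module), that $A$ is not a PI algebra (no nonzero polynomial in noncommuting variables over $k$ vanishes identically on $A$), and that $A$ satisfies the Nullstellensatz, in the sense that for every simple $A$-module $M$ the $k$-algebra $\operatorname{End}_A(M)$ is algebraic over $k$. Here modules are taken on one fixed side (say left modules) throughout. Then $A$ is stably just infinite: $A\otimes_k K$ is a just infinite $K$-algebra for every field extension $K/k$. -/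

import Mathlib

open scoped TensorProduct

/-- `A` is just infinite over `k`: it is infinite dimensional and every nonzero two-sided ideal
has finite codimension. Here `I.ringCon.Quotient` is the `k`-algebra `A / I`. -/
def IsJustInfinite (k A : Type*) [Field k] [Ring A] [Algebra k A] : Prop :=
  ¬ FiniteDimensional k A ∧
    ∀ I : TwoSidedIdeal A, I ≠ ⊥ → FiniteDimensional k I.ringCon.Quotient

/-- `A` is stably just infinite over `k`: it is just infinite, and its scalar extension to every
field extension `K` of `k` is just infinite over `K`. -/
def IsStablyJustInfinite.{w, u, v} (k : Type u) (A : Type v) [Field k] [Ring A] [Algebra k A] :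
    Prop :=
  IsJustInfinite k A ∧
    ∀ (K : Type w) [Field K] [Algebra k K], IsJustInfinite K (K ⊗[k] A)

/-- `A` is a PI algebra: some nonzero noncommutative polynomial over `k` vanishes under every
substitution of elements of `A`. -/
def IsPIAlgebra (k A : Type*) [Field k] [Ring A] [Algebra k A] : Prop :=
  ∃ p : FreeAlgebra k ℕ, p ≠ 0 ∧ ∀ a : ℕ → A, FreeAlgebra.lift k a p = 0

/-- `A` is a primitive ring: it has a faithful simple module. (Up to isomorphism every simple
`A`-module lives in the universe of `A`.) -/
def IsPrimitiveRing.{v} (A : Type v) [Ring A] : Prop :=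
  ∃ (M : Type v) (_ : AddCommGroup M) (_ : Module A M), IsSimpleModule A M ∧ FaithfulSMul A M

/-- The Nullstellensatz for the `k`-algebra `A`: the endomorphism ring of every simple `A`-module
is algebraic over `k`. The action of `k` on `M` is the one induced from `A`. (Some authors also ask
that the Jacobson radical of every factor ring of `A` be nil; this is not required here, so the
condition is implied by theirs.) -/
def SatisfiesNullstellensatz.{u, v} (k : Type u) (A : Type v) [Field k] [Ring A] [Algebra k A] :
    Prop :=
  ∀ (M : Type v) [AddCommGroup M] [Module A M] [Module k M] [IsScalarTower k A M]
    [IsSimpleModule A M], Algebra.IsAlgebraic k (Module.End A M)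

universe w u v

/-! By Schur's lemma and the Nullstellensatz, the endomorphisms of a faithful simple module form a
division algebra algebraic over `k`, hence `k` itself. This makes `A` centrally closed: `a * r * b =
b * r * a` for all `r`, with `a ≠ 0`, gives `b ∈ k a`. A shortest nonzero element of an ideal `I` of
`K ⊗ A` is then a pure tensor `d ⊗ a`, so `1 ⊗ a ∈ I`. Since `(a)` has finite codimension in `A`, so
has `I` over `K`. -/

open TensorProduct in
theorem TensorProduct.equivFinsuppOfBasisLeft_one_tmul_mul_apply {k K A ι : Type*} [Field k]
    [Field K] [Algebra k K] [Ring A] [Algebra k A] [DecidableEq ι] (b : Module.Basis ι k K) (s : A)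
    (x : K ⊗[k] A) (i : ι) :
    equivFinsuppOfBasisLeft b (((1 : K) ⊗ₜ[k] s) * x) i = s * equivFinsuppOfBasisLeft b x i := by
  induction x with
  | zero => simp
  | tmul c a => simp
  | add x y hx hy => simp only [mul_add, map_add, Finsupp.add_apply, hx, hy]

open TensorProduct in
theorem TensorProduct.equivFinsuppOfBasisLeft_mul_one_tmul_apply {k K A ι : Type*} [Field k]
    [Field K] [Algebra k K] [Ring A] [Algebra k A] [DecidableEq ι] (b : Module.Basis ι k K) (s : A)
    (x : K ⊗[k] A) (i : ι) :
    equivFinsuppOfBasisLeft b (x * ((1 : K) ⊗ₜ[k] s)) i = equivFinsuppOfBasisLeft b x i * s := by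
  induction x with
  | zero => simp
  | tmul c a => simp
  | add x y hx hy => simp only [add_mul, map_add, Finsupp.add_apply, hx, hy]

/-- In a primitive algebra with a faithful simple module all of whose endomorphisms are scalars,
the identity `a * r * b = b * r * a` forces `b` to be a scalar multiple of `a`. -/
theorem exists_smul_eq_of_mul_mul_comm {k A M : Type*} [Field k] [Ring A] [Algebra k A]
    [AddCommGroup M] [Module A M] [Module k M] [IsScalarTower k A M] [IsSimpleModule A M]
    [FaithfulSMul A M] (hE : Function.Surjective (algebraMap k (Module.End A M)))
    {a b : A} (ha : a ≠ 0) (hab : ∀ r, a * r * b = b * r * a) : ∃ c : k, b = c • a := by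
  obtain ⟨m, hm⟩ : ∃ m : M, a • m ≠ 0 := by
    by_contra! h
    exact ha (FaithfulSMul.eq_of_smul_eq_smul (α := M) fun m => by rw [h m, zero_smul])
  have hcomm (r : A) : a • r • b • m = b • r • a • m := by
    simpa only [mul_smul] using congrArg (· • m) (hab r)
  have hsurj : Function.Surjective (LinearMap.toSpanSingleton A M (a • m)) :=
    IsSimpleModule.toSpanSingleton_surjective A hm
  -- This makes `a • m ↦ b • m` a well-defined endomorphism. If `r • a • m = 0` but `s • r • b • m =
  -- m`, then `a • m = a • s • r • b • m = b • s • r • a • m = 0`.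
  have hker : LinearMap.ker (LinearMap.toSpanSingleton A M (a • m)) ≤
      LinearMap.ker (LinearMap.toSpanSingleton A M (b • m)) := by
    intro r hr
    simp only [LinearMap.mem_ker, LinearMap.toSpanSingleton_apply] at hr ⊢
    by_contra hne
    obtain ⟨s, hs⟩ := IsSimpleModule.toSpanSingleton_surjective A hne m
    rw [LinearMap.toSpanSingleton_apply] at hs
    apply hm
    rw [← hs, ← mul_smul s r, hcomm, mul_smul, hr, smul_zero, smul_zero]
  let f : Module.End A M := (Submodule.liftQ _ _ hker) ∘ₗ
    (LinearMap.quotKerEquivOfSurjective _ hsurj).symm.toLinearMap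
  obtain ⟨c, hc⟩ := hE f
  have hf : f (a • m) = b • m := by
    have : (LinearMap.quotKerEquivOfSurjective _ hsurj).symm (a • m) =
        Submodule.Quotient.mk 1 := by
      rw [LinearEquiv.symm_apply_eq, LinearMap.quotKerEquivOfSurjective_apply_mk,
        LinearMap.toSpanSingleton_apply, one_smul]
    simp only [f, LinearMap.comp_apply, LinearEquiv.coe_coe, this, Submodule.liftQ_apply,
      LinearMap.toSpanSingleton_apply, one_smul]
  rw [← hc, Module.algebraMap_end_apply] at hf
  refine ⟨c, FaithfulSMul.eq_of_smul_eq_smul (α := M) fun v => ?_⟩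
  obtain ⟨r, rfl⟩ := hsurj v
  rw [LinearMap.toSpanSingleton_apply, ← hcomm, ← hf, smul_assoc, ← algebraMap_smul A c (a • m),
    ← algebraMap_smul A c (a • r • a • m)]
  simp only [← mul_smul]
  simp only [← mul_assoc, Algebra.commutes c]

/-- If `a * r * b = b * r * a` for all `r` forces `b` to be a multiple of `a` whenever `a ≠ 0`, then
every nonzero ideal of a scalar extension of `A` contains a nonzero element of `A`. -/
theorem TwoSidedIdeal.exists_one_tmul_mem {k K A : Type*} [Field k] [Field K] [Algebra k K]
    [Ring A] [Algebra k A]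
    (hA : ∀ a b : A, a ≠ 0 → (∀ r, a * r * b = b * r * a) → ∃ c : k, b = c • a)
    (I : TwoSidedIdeal (K ⊗[k] A)) (hI : I ≠ ⊥) : ∃ a : A, a ≠ 0 ∧ (1 : K) ⊗ₜ[k] a ∈ I := by
  classical
  let b := Module.Basis.ofVectorSpace k K
  let φ := TensorProduct.equivFinsuppOfBasisLeft (N := A) b
  obtain ⟨y, hyI, hy⟩ : ∃ y ∈ I, y ≠ 0 := by
    by_contra! h
    exact hI (eq_bot_iff.mpr fun y hy => h y hy)
  obtain ⟨x, ⟨hxI, hx⟩, hmin⟩ := WellFounded.has_min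
    (measure fun x => (φ x).support.card).wf {x | x ∈ I ∧ x ≠ 0} ⟨y, hyI, hy⟩
  obtain ⟨i, hi⟩ : ∃ i, φ x i ≠ 0 := by
    by_contra! h
    exact hx (φ.map_eq_zero_iff.mp (Finsupp.ext h))
  have key (j) (r : A) : φ x i * r * φ x j = φ x j * r * φ x i := by
    -- Chosen to cancel the `i`-th coefficient without enlarging the support; minimality of `x`
    -- forces `z = 0`, and its `j`-th coefficient is the identity sought.
    let z := ((1 : K) ⊗ₜ[k] (φ x i * r)) * x - x * ((1 : K) ⊗ₜ[k] (r * φ x i))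
    have hz (j) : φ z j = φ x i * r * φ x j - φ x j * (r * φ x i) := by
      simp only [z, φ, map_sub, Finsupp.sub_apply,
        TensorProduct.equivFinsuppOfBasisLeft_one_tmul_mul_apply,
        TensorProduct.equivFinsuppOfBasisLeft_mul_one_tmul_apply]
    have hz0 : z = 0 := by
      by_contra hne
      refine hmin z ⟨I.sub_mem (I.mul_mem_left _ _ hxI) (I.mul_mem_right _ _ hxI), hne⟩
        (Finset.card_lt_card (Finset.ssubset_iff_of_subset ?_ |>.mpr ⟨i, ?_, ?_⟩))
      · intro j hj
        rw [Finsupp.mem_support_iff] at hj ⊢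
        intro h
        exact hj (by rw [hz, h, mul_zero, zero_mul, sub_zero])
      · rwa [Finsupp.mem_support_iff]
      · rw [Finsupp.notMem_support_iff, hz, mul_assoc, sub_self]
    have := hz j
    rw [hz0, map_zero, Finsupp.zero_apply] at this
    rw [mul_assoc (φ x j)]
    exact (sub_eq_zero.mp this.symm)
  choose c hc using fun j => hA (φ x i) (φ x j) hi (key j)
  have hx' : x = (∑ j ∈ (φ x).support, c j • b j) ⊗ₜ[k] φ x i := by
    conv_lhs => rw [← φ.symm_apply_apply x]
    rw [TensorProduct.equivFinsuppOfBasisLeft_symm_apply, Finsupp.sum, TensorProduct.sum_tmul]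
    refine Finset.sum_congr rfl fun j _ => ?_
    rw [hc j, TensorProduct.tmul_smul, TensorProduct.smul_tmul']
  set d : K := ∑ j ∈ (φ x).support, c j • b j
  have hd : d ≠ 0 := by
    rintro h
    rw [h, TensorProduct.zero_tmul] at hx'
    exact hx hx'
  refine ⟨φ x i, hi, ?_⟩
  have := I.mul_mem_left (d⁻¹ ⊗ₜ[k] (1 : A)) x hxI
  rw [hx', Algebra.TensorProduct.tmul_mul_tmul, inv_mul_cancel₀ hd, one_mul] at this
  exact this

/-- The projection onto `(K ⊗ A) / I` factors through the finite-dimensional `K ⊗ (A / J)`: for a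
`k`-linear section `σ` of `A → A / J`, `a` and `σ (π a)` differ by an element of `J`. -/
theorem TwoSidedIdeal.finite_quotient_of_le_comap {k K A : Type*} [Field k] [Field K]
    [Algebra k K] [Ring A] [Algebra k A] (J : TwoSidedIdeal A) (I : TwoSidedIdeal (K ⊗[k] A))
    (hJI : ∀ a ∈ J, (1 : K) ⊗ₜ[k] a ∈ I) [FiniteDimensional k J.ringCon.Quotient] :
    FiniteDimensional K I.ringCon.Quotient := by
  let π : A →ₗ[k] J.ringCon.Quotient :=
    { toFun := fun a => (a : J.ringCon.Quotient)
      map_add' := fun _ _ => rfl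
      map_smul' := fun _ _ => rfl }
  let ψ : K ⊗[k] A →ₗ[K] I.ringCon.Quotient :=
    { toFun := fun a => (a : I.ringCon.Quotient)
      map_add' := fun _ _ => rfl
      map_smul' := fun _ _ => rfl }
  have hπ : Function.Surjective π := Quotient.mk_surjective
  have hψ : Function.Surjective ψ := Quotient.mk_surjective
  obtain ⟨σ, hσ⟩ := π.exists_rightInverse_of_surjective (LinearMap.range_eq_top.mpr hπ)
  have hfac : ψ = ψ ∘ₗ σ.baseChange K ∘ₗ π.baseChange K := by
    apply TensorProduct.AlgebraTensorModule.curry_injective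
    ext a
    simp only [TensorProduct.AlgebraTensorModule.curry_apply, TensorProduct.curry_apply,
      LinearMap.coe_restrictScalars, LinearMap.comp_apply,
      LinearMap.baseChange_tmul]
    refine (RingCon.eq _).mpr ((TwoSidedIdeal.rel_iff _ _ _).mpr ?_)
    rw [← TensorProduct.tmul_sub]
    refine hJI _ ((TwoSidedIdeal.rel_iff _ _ _).mp ((RingCon.eq _).mp ?_))
    exact (LinearMap.congr_fun hσ (π a)).symm
  refine Module.Finite.of_surjective (ψ ∘ₗ σ.baseChange K) fun y => ?_
  obtain ⟨x, rfl⟩ := hψ y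
  exact ⟨π.baseChange K x, (LinearMap.congr_fun hfac x).symm⟩

theorem mainTheorem11 (k : Type u) [Field k] [IsAlgClosed k]
    (A : Type v) [Ring A] [Algebra k A]
    (hprim : IsPrimitiveRing A) (hPI : ¬ IsPIAlgebra k A) (hA : IsJustInfinite k A)
    (hN : SatisfiesNullstellensatz k A) :
    IsStablyJustInfinite.{w} k A := by
  classical
  refine ⟨hA, fun K _ _ => ⟨fun hfin => ?_, fun I hI => ?_⟩⟩
  · exact hA.1 (Module.Finite.of_finite_tensorProduct_of_faithfullyFlat (T := K))
  · obtain ⟨M, _, _, _, _⟩ := hprim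
    let : Module k M := Module.compHom M (algebraMap k A)
    have : IsScalarTower k A M := ⟨fun c a m => by
      rw [Algebra.smul_def, mul_smul]; rfl⟩
    have : Algebra.IsAlgebraic k (Module.End A M) := hN M
    obtain ⟨a, ha, haI⟩ := TwoSidedIdeal.exists_one_tmul_mem (k := k)
      (fun a b ha hab => exists_smul_eq_of_mul_mul_comm (M := M)
        IsAlgClosed.algebraMap_bijective_of_isIntegral.2 ha hab) I hI
    have hle : TwoSidedIdeal.span {a} ≤ TwoSidedIdeal.comap
        (Algebra.TensorProduct.includeRight : A →ₐ[k] K ⊗[k] A) I := by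
      rw [TwoSidedIdeal.span_le, Set.singleton_subset_iff]
      exact (TwoSidedIdeal.mem_comap _).mpr haI
    have := hA.2 (TwoSidedIdeal.span {a}) fun h => ha <| by
      have : a ∈ TwoSidedIdeal.span {a} := TwoSidedIdeal.subset_span rfl
      rwa [h] at this
    exact TwoSidedIdeal.finite_quotient_of_le_comap (TwoSidedIdeal.span {a}) I
      fun x hx => (TwoSidedIdeal.mem_comap
        (Algebra.TensorProduct.includeRight : A →ₐ[k] K ⊗[k] A)).mp (hle hx)
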